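/- Let $r\ge 0$, $0\le q\le r$, $m\ge 1$ and $k_1,\dots,k_r\ge 1$ be integers, and let $K$ be a field. For a family $n=(n_j)$ of non-negative integers, finitely many but not none of them nonzero, let $$M(\{n_j\})=\frac{1}{\sum_j n_j}\sum_{d\,\mid\, n_j\ \text{for all } j}\mu(d)\,\frac{\bigl(\frac{1}{d}\sum_j n_j\bigr)!}{\prod_j\bigl(\frac{n_j}{d}\bigr)!},$$ where $\mu$ is the Möbius function (Witt's second formula). Consider the free Lie algebra over $K$ on $x_1,\dots,x_r$. A commutator is an iterated bracket of generators; $x_i$ has order $k_i$, and the order of $[u,v]$ is the sum of the orders of $u$ and $v$. Then the number of linearly independent commutators of order $m$, that is, the dimension of the subspace spanned by all commutators of order $m$, is finite and equal to $$\sum_{\sum_{i=1}^r k_in_i=m}M(\{n_i\}_{1\le i\le r})=\sum_{\sum_{i=q+1}^r k_in_i=m}M(\{n_i\}_{q+1\le i\le r})+\sum_{n\in N_m}M(n).$$ Here $\Lambda$ is the set of all tuples $(i;t_1,\dots,t_{l-1})$ with $l\ge 1$, $1\le i\le q$ and $t_j\in\{q+1,\dots,r\}$, which index the elements $\mathrm{ad}(x_{t_1})\cdots\mathrm{ad}(x_{t_{l-1}})(x_i)$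 of order $k_i+\sum_{j=1}^{l-1}k_{t_j}$, and $N_m$ is the set of families $n=(n_\lambda)_{\lambda\in\Lambda}$ of non-negative integers, finitely many nonzero, with $$\sum_{\lambda=(i;t_1,\dots,t_{l-1})\in\Lambda}\Bigl(k_i+\sum_{j=1}^{l-1}k_{t_j}\Bigr)n_\lambda=m.$$ All three sums run over families of non-negative integers and have finitely many terms. -/

import Mathlib

namespace WittCount

/-- Witt's second formula: for a family of multiplicities `n = (n_j)`, finitely many nonzero,
`M(n) = (1 / ∑ n_j) ∑_{d ∣ n_j for all j} μ(d) ((∑ n_j) / d)! / ∏ (n_j / d)!`.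
The common divisors of the `n_j` are the divisors of their gcd; indices with `n_j = 0` contribute
the factor `0! = 1` to the product. The formula is meant for `n ≠ 0`. -/
noncomputable def wittM {ι : Type*} (n : ι →₀ ℕ) : ℚ :=
  (1 / ((∑ j ∈ n.support, n j : ℕ) : ℚ)) *
    ∑ d ∈ (n.support.gcd n).divisors,
      (ArithmeticFunction.moebius d : ℚ) *
        (((((∑ j ∈ n.support, n j) / d).factorial : ℕ) : ℚ) /
          ((∏ j ∈ n.support, (n j / d).factorial : ℕ) : ℚ))

/-- The families of multiplicities `n = (n_j)`, finitely many nonzero, with `∑ k_j n_j = m`. -/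
def multiplicities {ι : Type*} (k : ι → ℕ) (m : ℕ) : Set (ι →₀ ℕ) :=
  {n | ∑ j ∈ n.support, k j * n j = m}

/-- `IsCommutator K k m u` says that the element `u` of the free Lie algebra over `K` on the
indeterminates `x_j`, `j : ι`, is a commutator (an iterated bracket of indeterminates) of order `m`,
where `x_j` has order `k j` and orders add up under the bracket. -/
inductive IsCommutator (K : Type*) [Field K] {ι : Type*} (k : ι → ℕ) :
    ℕ → FreeLieAlgebra K ι → Prop
  | of (j : ι) : IsCommutator K k (k j) (FreeLieAlgebra.of K j)
  | lie {a b : ℕ} {u v : FreeLieAlgebra K ι} :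
      IsCommutator K k a u → IsCommutator K k b v → IsCommutator K k (a + b) ⁅u, v⁆

/-- The subspace of the free Lie algebra spanned by the commutators of order `m`. Its dimension is
the number of (linearly) independent commutators of order `m`. -/
noncomputable def commutatorSpan (K : Type*) [Field K] {ι : Type*} (k : ι → ℕ) (m : ℕ) :
    Submodule K (FreeLieAlgebra K ι) :=
  Submodule.span K {u | IsCommutator K k m u}

/-- The indices of the first `q` of `r` generators. -/
abbrev FirstIdx (r q : ℕ) : Type := {i : Fin r // (i : ℕ) < q}

/-- The indices of the last `r - q` of `r` generators. -/
abbrev LastIdx (r q : ℕ) : Type := {t : Fin r // q ≤ (t : ℕ)}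

/-- The index set of the elements `ad(x_{t_1}) ⋯ ad(x_{t_{l-1}}) (x_i)`, where `l ≥ 1`, `x_i` is one
of the first `q` generators and the `x_{t_j}` are among the last `r - q`: the pairs of `i` and the
finite (possibly empty) sequence `t_1, …, t_{l-1}`. -/
abbrev AdIdx (r q : ℕ) : Type := FirstIdx r q × List (LastIdx r q)

/-- The order `k_i + ∑_j k_{t_j}` of `ad(x_{t_1}) ⋯ ad(x_{t_{l-1}}) (x_i)`. -/
def adOrder {r : ℕ} (q : ℕ) (k : Fin r → ℕ) (a : AdIdx r q) : ℕ :=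
  k a.1.1 + (a.2.map fun t => k t.1).sum

end WittCount

/-!
The proof rests on Lazard elimination. If the generators of a free Lie algebra are split into two
alphabets `X` and `Y`, the letters `ad(y_1) ⋯ ad(y_l) (x)` freely generate an ideal whose complement
is the free Lie algebra on `Y`.

On the algebraic side only the elimination of a single letter `x` is needed. The free Lie algebra on
the letters `ad(x)^l (y)`, `y ≠ x`, carries the derivation `ad(x)^l (y) ↦ ad(x)^(l+1) (y)`, and its
semidirect product with a line is the original free Lie algebra. Hence the dimension in order `m`
drops by one if `x` has order `m` and does not change otherwise (`finrank_commutatorSpan_elim`).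

On the numerical side, let `A` be the series counting the letters by weight. Then `m` times Witt's
sum in weight `m` is `∑_{d ∣ m} μ(d) T_{m/d}`, where `∑ T_j X^j = X A' / (1 - A)` is `X` times the
logarithmic derivative of `1 / (1 - A)` (`mul_wittSum`, `cyclicSeries_eq`). Elimination factors
`1 - A` as the product of the two corresponding series, so Witt's sums add up
(`wittSum_elimination`), which is the generalized McLachlan formula. For a single letter Witt's sum
is `1` in the weight of the letter and `0` elsewhere (`wittSum_single`).

So the dimension and Witt's sum change in the same way when a letter is eliminated. Eliminating
letters of minimal weight one after the other leaves, after finitely many steps, only letters of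
weight greater than `m`, for which both vanish (`finrank_commutatorSpan`). The alphabet becomes
infinite on the way, but keeps finitely many letters of each weight.
-/

namespace WittCount

open FreeLieAlgebra

/-! ### Elimination of one generator of a free Lie algebra -/

section Elimination

variable {K : Type*} [Field K] {ι : Type*}

/-- A map on the generators extends to a derivation of the free Lie algebra. The derivation is the
second component of the homomorphism `u ↦ (u, D u)` into the semidirect product of the free Lie
algebra with its adjoint module, obtained in Mathlib as the extension by the zero cocycle. -/
theorem exists_lieDerivation_of (f : ι → FreeLieAlgebra K ι) :
    ∃ D : LieDerivation K (FreeLieAlgebra K ι) (FreeLieAlgebra K ι),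
      ∀ j, D (of K j) = f j := by
  let c : LieModule.Cohomology.twoCocycle K (FreeLieAlgebra K ι) (FreeLieAlgebra K ι) := 0
  let F : FreeLieAlgebra K ι →ₗ⁅K⁆ LieAlgebra.ofTwoCocycle c :=
    lift K fun j => LieAlgebra.ofProd c (of K j, f j)
  let p : LieAlgebra.ofTwoCocycle c →ₗ⁅K⁆ FreeLieAlgebra K ι :=
    { toFun := fun z => z.carrier.1
      map_add' := fun _ _ => rfl
      map_smul' := fun _ _ => rfl
      map_lie' := rfl }
  have hp : ∀ u, (F u).carrier.1 = u := fun u => by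
    have h : p.comp F = LieHom.id := hom_ext fun j => by
      simp only [LieHom.comp_apply, F, lift_of_apply]
      rfl
    exact LieHom.congr_fun h u
  let E : FreeLieAlgebra K ι →ₗ[K] FreeLieAlgebra K ι :=
    { toFun := fun u => (F u).carrier.2
      map_add' := fun u v => by rw [map_add]; rfl
      map_smul' := fun r u => by rw [map_smul]; rfl }
  refine ⟨⟨E, fun a b => ?_⟩, fun j => ?_⟩
  · have h : (F ⁅a, b⁆).carrier.2 = 0 + ⁅(F a).carrier.1, (F b).carrier.2⁆
        - ⁅(F b).carrier.1, (F a).carrier.2⁆ := by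
      rw [LieHom.map_lie]
      rfl
    rw [hp, hp, zero_add] at h
    exact h
  · change (F (of K j)).carrier.2 = f j
    simp only [F, lift_of_apply]
    rfl

theorem lie_mem_commutatorSpan {k : ι → ℕ} {a b : ℕ} {u v : FreeLieAlgebra K ι}
    (hu : u ∈ commutatorSpan K k a) (hv : v ∈ commutatorSpan K k b) :
    ⁅u, v⁆ ∈ commutatorSpan K k (a + b) := by
  induction hu, hv using Submodule.span_induction₂ with
  | mem_mem x y hx hy => exact Submodule.subset_span (hx.lie hy)
  | zero_left y hy => simp
  | zero_right x hx => simp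
  | add_left x y z _ _ _ hx hy => rw [add_lie]; exact add_mem hx hy
  | add_right x y z _ _ _ hx hy => rw [lie_add]; exact add_mem hx hy
  | smul_left r x y _ _ h => rw [smul_lie]; exact Submodule.smul_mem _ _ h
  | smul_right r x y _ _ h => rw [lie_smul]; exact Submodule.smul_mem _ _ h

theorem of_mem_commutatorSpan (k : ι → ℕ) (j : ι) : of K j ∈ commutatorSpan K k (k j) :=
  Submodule.subset_span (.of j)

/-- The weight of the letter `ad(y_1) ⋯ ad(y_l) (x)`, encoded by the pair of `x : X` and the list
`[y_1, …, y_l]`, when the letters of `X` and `Y` have the weights `k₁` and `k₂`. -/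
def adWeight {X Y : Type*} (k₁ : X → ℕ) (k₂ : Y → ℕ) (a : X × List Y) : ℕ :=
  k₁ a.1 + (a.2.map k₂).sum

/-- The alphabet left by the elimination of the letter `x`: the pair of `y ≠ x` and a list of
length `l` stands for `ad(x)^l (y)`. The exponent is a list over `Unit`, not a natural number, so
that these are the letters of `adWeight` for the one-letter alphabet `Unit`. -/
abbrev ElimIdx (x : ι) : Type _ := {y : ι // y ≠ x} × List Unit

/-- The weight of the letter `ad(x)^l (y)`. -/
abbrev elimWeight (k : ι → ℕ) (x : ι) : ElimIdx x → ℕ :=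
  adWeight (fun y : {y : ι // y ≠ x} => k y) fun _ : Unit => k x

theorem elimWeight_cons (k : ι → ℕ) (x : ι) (y : {y : ι // y ≠ x}) (l : List Unit) :
    elimWeight k x (y, () :: l) = k x + elimWeight k x (y, l) := by
  simp only [elimWeight, adWeight, List.map_cons, List.sum_cons]
  omega

variable (K) in
/-- The homomorphism sending the letter `(y, l)` to `ad(x)^l (y)`. -/
noncomputable def elimHom (x : ι) : FreeLieAlgebra K (ElimIdx x) →ₗ⁅K⁆ FreeLieAlgebra K ι :=
  lift K fun a => a.2.foldr (fun _ u => ⁅of K x, u⁆) (of K a.1.1)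

theorem elimHom_nil (x : ι) (y : {y : ι // y ≠ x}) :
    elimHom K x (of K (y, [])) = of K y.1 := by
  simp [elimHom]

theorem elimHom_cons (x : ι) (y : {y : ι // y ≠ x}) (l : List Unit) :
    elimHom K x (of K (y, () :: l)) = ⁅of K x, elimHom K x (of K (y, l))⁆ := by
  simp [elimHom]

variable (K) in
/-- The derivation sending the letter `ad(x)^l (y)` to `ad(x)^(l+1) (y)`. It corresponds to `ad x`
under `elimHom`. -/
noncomputable def elimDerivation (x : ι) :
    LieDerivation K (FreeLieAlgebra K (ElimIdx x)) (FreeLieAlgebra K (ElimIdx x)) :=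
  (exists_lieDerivation_of fun a : ElimIdx x => of K (a.1, () :: a.2)).choose

theorem elimDerivation_of (x : ι) (a : ElimIdx x) :
    elimDerivation K x (of K a) = of K (a.1, () :: a.2) :=
  (exists_lieDerivation_of fun a : ElimIdx x => of K (a.1, () :: a.2)).choose_spec a

theorem elimHom_elimDerivation {k : ι → ℕ} {x : ι} {m : ℕ} {u : FreeLieAlgebra K (ElimIdx x)}
    (hu : u ∈ commutatorSpan K (elimWeight k x) m) :
    elimHom K x (elimDerivation K x u) = ⁅of K x, elimHom K x u⁆ := by
  induction hu using Submodule.span_induction with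
  | mem u hu =>
    induction hu with
    | of a => rw [elimDerivation_of, elimHom_cons]
    | lie _ _ hu hv =>
      rw [LieDerivation.apply_lie_eq_add, map_add, LieHom.map_lie, LieHom.map_lie, hu, hv,
        LieHom.map_lie, leibniz_lie (of K x), add_comm]
  | zero => simp
  | add u v _ _ hu hv => rw [map_add, map_add, hu, hv, map_add, lie_add]
  | smul r u _ hu => rw [map_smul, map_smul, hu, map_smul, lie_smul]

theorem elimDerivation_mem {k : ι → ℕ} {x : ι} {m : ℕ} {u : FreeLieAlgebra K (ElimIdx x)}
    (hu : u ∈ commutatorSpan K (elimWeight k x) m) :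
    elimDerivation K x u ∈ commutatorSpan K (elimWeight k x) (k x + m) := by
  induction hu using Submodule.span_induction with
  | mem u hu =>
    induction hu with
    | of a =>
      rw [elimDerivation_of, ← elimWeight_cons]
      exact of_mem_commutatorSpan _ _
    | @lie a b u v hu' hv' hu hv =>
      rw [LieDerivation.apply_lie_eq_add]
      refine add_mem ?_ ?_
      · have := lie_mem_commutatorSpan (Submodule.subset_span hu') hv
        rwa [add_left_comm] at this
      · have := lie_mem_commutatorSpan hu (Submodule.subset_span hv')
        rwa [add_assoc] at this
  | zero => simp
  | add u v _ _ hu hv => rw [map_add]; exact add_mem hu hv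
  | smul r u _ hu => rw [map_smul]; exact Submodule.smul_mem _ _ hu

theorem elimHom_mem {k : ι → ℕ} {x : ι} {m : ℕ} {u : FreeLieAlgebra K (ElimIdx x)}
    (hu : u ∈ commutatorSpan K (elimWeight k x) m) :
    elimHom K x u ∈ commutatorSpan K k m := by
  induction hu using Submodule.span_induction with
  | mem u hu =>
    induction hu with
    | of a =>
      obtain ⟨y, l⟩ := a
      induction l with
      | nil =>
        rw [elimHom_nil]
        exact of_mem_commutatorSpan k y.1
      | cons t l ih =>
        rw [elimHom_cons, elimWeight_cons]
        exact lie_mem_commutatorSpan (of_mem_commutatorSpan k x) ih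
    | lie _ _ hu hv =>
      rw [LieHom.map_lie]
      exact lie_mem_commutatorSpan hu hv
  | zero => simp
  | add u v _ _ hu hv => rw [map_add]; exact add_mem hu hv
  | smul r u _ hu => rw [map_smul]; exact Submodule.smul_mem _ _ hu

variable (K) in
/-- The part of order `m` of the line spanned by the letter `x`. -/
noncomputable def letterSpan (k : ι → ℕ) (x : ι) (m : ℕ) : Submodule K (FreeLieAlgebra K ι) :=
  if k x = m then K ∙ of K x else ⊥

theorem exists_smul_of_mem_letterSpan {k : ι → ℕ} {x : ι} {m : ℕ} {u : FreeLieAlgebra K ι}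
    (hu : u ∈ letterSpan K k x m) : ∃ r : K, u = r • of K x ∧ (r = 0 ∨ k x = m) := by
  unfold letterSpan at hu
  split_ifs at hu with h
  · obtain ⟨r, rfl⟩ := Submodule.mem_span_singleton.mp hu
    exact ⟨r, rfl, .inr h⟩
  · exact ⟨0, by simpa using hu, .inl rfl⟩

theorem lie_mem_of_mem_letterSpan {k : ι → ℕ} {x : ι} {a b : ℕ} {u : FreeLieAlgebra K ι}
    {v : FreeLieAlgebra K (ElimIdx x)}
    (hu : u ∈ letterSpan K k x a) (hv : v ∈ commutatorSpan K (elimWeight k x) b) :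
    ⁅u, elimHom K x v⁆ ∈
      (commutatorSpan K (elimWeight k x) (a + b)).map (elimHom K x).toLinearMap := by
  obtain ⟨r, rfl, rfl | rfl⟩ := exists_smul_of_mem_letterSpan hu
  · simp
  · rw [smul_lie, ← elimHom_elimDerivation hv]
    exact Submodule.smul_mem _ _ (Submodule.mem_map_of_mem (elimDerivation_mem hv))

/-- The commutators in the letters `ad(x)^l (y)`, together with `x` itself, span: this span is
closed under the bracket, since `ad x` acts on the first part as a derivation. -/
theorem commutatorSpan_eq_sup (k : ι → ℕ) (x : ι) (m : ℕ) :
    commutatorSpan K k m =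
      (commutatorSpan K (elimWeight k x) m).map (elimHom K x).toLinearMap ⊔
        letterSpan K k x m := by
  apply le_antisymm
  · refine Submodule.span_le.mpr fun u hu => ?_
    rw [SetLike.mem_coe]
    induction hu with
    | of j =>
      by_cases h : j = x
      · subst h
        refine Submodule.mem_sup_right ?_
        rw [letterSpan, if_pos rfl]
        exact Submodule.mem_span_singleton_self _
      · refine Submodule.mem_sup_left ⟨of K (⟨j, h⟩, []), ?_, elimHom_nil x ⟨j, h⟩⟩
        exact of_mem_commutatorSpan (elimWeight k x) (⟨j, h⟩, [])
    | @lie a b u v _ _ hu hv =>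
      obtain ⟨_, ⟨u₁, hu₁, rfl⟩, u₂, hu₂, rfl⟩ := Submodule.mem_sup.mp hu
      obtain ⟨_, ⟨v₁, hv₁, rfl⟩, v₂, hv₂, rfl⟩ := Submodule.mem_sup.mp hv
      refine Submodule.mem_sup_left ?_
      have h₁ : ⁅elimHom K x u₁, elimHom K x v₁⁆ ∈
          (commutatorSpan K (elimWeight k x) (a + b)).map (elimHom K x).toLinearMap := by
        rw [← LieHom.map_lie]
        exact Submodule.mem_map_of_mem (lie_mem_commutatorSpan hu₁ hv₁)
      have h₂ := lie_mem_of_mem_letterSpan hu₂ hv₁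
      have h₃ := neg_mem (lie_mem_of_mem_letterSpan hv₂ hu₁)
      rw [lie_skew, add_comm b] at h₃
      have h₄ : ⁅u₂, v₂⁆ = 0 := by
        obtain ⟨r, rfl, -⟩ := exists_smul_of_mem_letterSpan hu₂
        obtain ⟨s, rfl, -⟩ := exists_smul_of_mem_letterSpan hv₂
        simp
      rw [add_lie, lie_add, lie_add, h₄, add_zero]
      exact add_mem (add_mem h₁ h₃) h₂
  · refine sup_le ?_ ?_
    · rintro _ ⟨u, hu, rfl⟩
      exact elimHom_mem hu
    · unfold letterSpan
      split_ifs with h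
      · subst h
        rw [Submodule.span_singleton_le_iff_mem]
        exact of_mem_commutatorSpan k x
      · exact bot_le

/-- The decomposition of the free Lie algebra as the sum of the image of `elimHom` and the line of
`x` is direct and `elimHom` is injective: the components of the homomorphism to the semidirect
product of the smaller free Lie algebra with `K`, acting by `elimDerivation`, which sends `x` to
`1 : K` and `y` to the letter `(y, [])`, separate the two parts. -/
theorem exists_retraction_elimHom (x : ι) :
    ∃ (p : FreeLieAlgebra K ι →ₗ[K] FreeLieAlgebra K (ElimIdx x)) (e : FreeLieAlgebra K ι →ₗ[K] K),
      (∀ u, p (elimHom K x u) = u) ∧ (∀ u, e (elimHom K x u) = 0) ∧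
        p (of K x) = 0 ∧ e (of K x) = 1 := by
  classical
  let _ : LieRing K := LieRing.ofAssociativeRing
  let D := elimDerivation K x
  let ψ : K →ₗ⁅K⁆ LieDerivation K (FreeLieAlgebra K (ElimIdx x)) (FreeLieAlgebra K (ElimIdx x)) :=
    { toFun := fun r => r • D
      map_add' := fun r s => add_smul r s D
      map_smul' := fun r s => mul_smul r s D
      map_lie' := fun {r s} => by simp [LieRing.of_associative_ring_bracket, mul_comm] }
  let g : ι → LieAlgebra.SemiDirectSum (FreeLieAlgebra K (ElimIdx x)) K ψ := fun j =>
    if h : j = x then ⟨0, 1⟩ else ⟨of K (⟨j, h⟩, []), 0⟩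
  let φ := lift K g
  have hx : φ (of K x) = ⟨0, 1⟩ := by simp [φ, g]
  have h : φ.comp (elimHom K x) = LieAlgebra.SemiDirectSum.inl ψ := by
    refine hom_ext fun a => ?_
    obtain ⟨y, l⟩ := a
    rw [LieHom.comp_apply]
    induction l with
    | nil =>
      rw [elimHom_nil]
      simp [φ, g, y.2]
    | cons t l ih =>
      rw [elimHom_cons, LieHom.map_lie, ih, hx]
      simp [ψ, D, elimDerivation_of]
  have h' := fun u => LieHom.congr_fun h u
  simp only [LieHom.comp_apply] at h'
  refine ⟨LieAlgebra.SemiDirectSum.projl ψ ∘ₗ (φ : _ →ₗ[K] _),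
    ((LieAlgebra.SemiDirectSum.projr ψ).comp φ : _ →ₗ[K] _), fun u => ?_, fun u => ?_, ?_, ?_⟩
  all_goals simp [h', hx]

/-- Eliminating a letter of weight `k x` lowers the dimension by one in order `k x` and keeps it in
all other orders. -/
theorem finrank_commutatorSpan_elim (k : ι → ℕ) (x : ι) (m : ℕ)
    (hfin : Module.Finite K (commutatorSpan K (elimWeight k x) m)) :
    Module.Finite K (commutatorSpan K k m) ∧
      Module.finrank K (commutatorSpan K k m) =
        Module.finrank K (commutatorSpan K (elimWeight k x) m) + if k x = m then 1 else 0 := by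
  obtain ⟨p, e, hp, he, hpx, hex⟩ := exists_retraction_elimHom (K := K) x
  have hinj : Function.Injective (elimHom K x).toLinearMap :=
    fun u v h => by rw [← hp u, ← hp v]; exact congrArg p h
  have hline : Module.Finite K (letterSpan K k x m) ∧
      Module.finrank K (letterSpan K k x m) = if k x = m then 1 else 0 := by
    by_cases h : k x = m
    · rw [letterSpan, if_pos h, if_pos h]
      refine ⟨inferInstance, finrank_span_singleton fun h0 => ?_⟩
      rw [h0, map_zero] at hex
      exact zero_ne_one hex
    · rw [letterSpan, if_neg h, if_neg h]
      exact ⟨inferInstance, finrank_bot K _⟩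
  obtain ⟨hline, hrank⟩ := hline
  have hdisj : (commutatorSpan K (elimWeight k x) m).map (elimHom K x).toLinearMap ⊓
      letterSpan K k x m = ⊥ := by
    rw [Submodule.eq_bot_iff]
    rintro _ ⟨⟨u, -, rfl⟩, hu⟩
    obtain ⟨r, hr, -⟩ := exists_smul_of_mem_letterSpan hu
    have := congrArg e hr
    rw [LieHom.coe_toLinearMap, he, map_smul, hex, smul_eq_mul, mul_one] at this
    rw [hr, ← this, zero_smul]
  rw [commutatorSpan_eq_sup k x m]
  refine ⟨inferInstance, ?_⟩
  have := Submodule.finrank_sup_add_finrank_inf_eq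
    ((commutatorSpan K (elimWeight k x) m).map (elimHom K x).toLinearMap) (letterSpan K k x m)
  rw [hdisj, finrank_bot, add_zero] at this
  rw [this, hrank, LinearEquiv.finrank_eq (Submodule.equivMapOfInjective _ hinj _).symm]

end Elimination

/-! ### Multinomial coefficients and multiplicities -/

section Counting

open PowerSeries Finset

variable {ι : Type*} {k : ι → ℕ}

/-- The number `∑ n_j` of letters, counted with multiplicity. -/
def size (n : ι →₀ ℕ) : ℕ := ∑ j ∈ n.support, n j

/-- The multinomial coefficient `(∑ n_j)! / ∏ n_j!`, the number of words in which the letter `j`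
occurs `n_j` times, in the rational form that appears in `wittM`. -/
noncomputable def multinomialCoeff (n : ι →₀ ℕ) : ℚ :=
  ((size n).factorial : ℚ) / ((∏ j ∈ n.support, (n j).factorial : ℕ) : ℚ)

theorem mem_multiplicities_iff {s : Finset ι} {n : ι →₀ ℕ} {m : ℕ} (hs : n.support ⊆ s) :
    n ∈ multiplicities k m ↔ ∑ j ∈ s, k j * n j = m := by
  rw [← Finset.sum_subset hs (f := fun j => k j * n j) fun j _ hj => by
    rw [Finsupp.notMem_support_iff.mp hj, mul_zero]]
  rfl

theorem size_eq_sum {s : Finset ι} {n : ι →₀ ℕ} (hs : n.support ⊆ s) :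
    size n = ∑ j ∈ s, n j :=
  Finset.sum_subset hs fun _ _ hj => Finsupp.notMem_support_iff.mp hj

theorem multinomialCoeff_eq {s : Finset ι} {n : ι →₀ ℕ} (hs : n.support ⊆ s) :
    multinomialCoeff n =
      ((size n).factorial : ℚ) / ((∏ j ∈ s, (n j).factorial : ℕ) : ℚ) := by
  rw [multinomialCoeff, Finset.prod_subset hs fun j _ hj => by
    rw [Finsupp.notMem_support_iff.mp hj, Nat.factorial_zero]]

theorem size_eq_zero {n : ι →₀ ℕ} : size n = 0 ↔ n = 0 := by
  rw [size, Finset.sum_eq_zero_iff]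
  refine ⟨fun h => ?_, fun h => by simp [h]⟩
  ext j
  by_cases hj : j ∈ n.support
  · exact h j hj
  · exact Finsupp.notMem_support_iff.mp hj

theorem finite_setOf_le (hfin : ∀ n, {x | k x = n}.Finite) (m : ℕ) : {x | k x ≤ m}.Finite := by
  refine ((Set.finite_Iic m).biUnion fun n _ => hfin n).subset fun x hx => ?_
  simpa using hx

theorem multiplicities_finite (hk : ∀ x, 1 ≤ k x) (hfin : ∀ n, {x | k x = n}.Finite) (m : ℕ) :
    (multiplicities k m).Finite := by
  classical
  let S := (finite_setOf_le hfin m).toFinset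
  refine (Set.finite_Iic (Finsupp.indicator S fun _ _ => m)).subset fun n hn j => ?_
  by_cases hj : j ∈ n.support
  · have h : k j * n j ≤ m := by
      rw [← (show ∑ j ∈ n.support, k j * n j = m from hn)]
      exact Finset.single_le_sum (f := fun j => k j * n j) (fun _ _ => Nat.zero_le _) hj
    have h1 : 1 ≤ n j := Nat.one_le_iff_ne_zero.mpr (Finsupp.mem_support_iff.mp hj)
    have hS : j ∈ S := by
      simp only [S, Set.Finite.mem_toFinset, Set.mem_ofPred_eq]
      nlinarith
    rw [Finsupp.indicator_of_mem hS]
    nlinarith [hk j]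
  · rw [Finsupp.notMem_support_iff.mp hj]
    exact Nat.zero_le _

theorem add_single_mem_multiplicities {n : ι →₀ ℕ} {m : ℕ} (hn : n ∈ multiplicities k m) (x : ι) :
    n + Finsupp.single x 1 ∈ multiplicities k (k x + m) := by
  classical
  have hs : (n + Finsupp.single x 1).support ⊆ insert x n.support := by
    intro j; simp [Finsupp.single_apply]; grind
  rw [mem_multiplicities_iff hs]
  rw [mem_multiplicities_iff (Finset.subset_insert x _)] at hn
  simp only [Finsupp.add_apply, mul_add, Finset.sum_add_distrib, hn]
  rw [add_comm, Finset.sum_eq_single_of_mem x (Finset.mem_insert_self _ _) fun j _ hj => by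
    simp [Finsupp.single_eq_of_ne hj]]
  simp

theorem size_add_single (n : ι →₀ ℕ) (x : ι) : size (n + Finsupp.single x 1) = size n + 1 := by
  classical
  have hs : (n + Finsupp.single x 1).support ⊆ insert x n.support := by
    intro j; simp [Finsupp.single_apply]; grind
  rw [size_eq_sum hs, size_eq_sum (Finset.subset_insert x n.support)]
  simp only [Finsupp.add_apply, Finset.sum_add_distrib]
  rw [Finset.sum_eq_single_of_mem (f := fun j => (Finsupp.single x 1 : ι →₀ ℕ) j) x
    (Finset.mem_insert_self _ _) fun j _ hj => by simp [Finsupp.single_eq_of_ne hj]]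
  simp

theorem multinomialCoeff_add_single (n : ι →₀ ℕ) (x : ι) :
    multinomialCoeff (n + Finsupp.single x 1) * (n x + 1) = (size n + 1) * multinomialCoeff n := by
  classical
  have hs : (n + Finsupp.single x 1).support ⊆ insert x n.support := by
    intro j; simp [Finsupp.single_apply]; grind
  rw [multinomialCoeff_eq hs, multinomialCoeff_eq (Finset.subset_insert x n.support),
    size_add_single, ← Finset.mul_prod_erase _ _ (Finset.mem_insert_self x n.support),
    ← Finset.mul_prod_erase (insert x n.support) (fun j => (n j).factorial)
      (Finset.mem_insert_self x n.support)]
  have h : ∏ j ∈ (insert x n.support).erase x, ((n + Finsupp.single x 1 : ι →₀ ℕ) j).factorial =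
      ∏ j ∈ (insert x n.support).erase x, (n j).factorial :=
    Finset.prod_congr rfl fun j hj => by
      rw [Finsupp.add_apply, Finsupp.single_eq_of_ne (Finset.ne_of_mem_erase hj), add_zero]
  rw [h, Finsupp.add_apply, Finsupp.single_eq_same, Nat.factorial_succ, Nat.factorial_succ]
  have h1 : ((∏ j ∈ (insert x n.support).erase x, (n j).factorial : ℕ) : ℚ) ≠ 0 :=
    Nat.cast_ne_zero.mpr (Finset.prod_ne_zero_iff.mpr fun j _ => Nat.factorial_ne_zero _)
  have h2 : ((n x).factorial : ℚ) ≠ 0 := Nat.cast_ne_zero.mpr (Nat.factorial_ne_zero _)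
  have h3 : (n x + 1 : ℚ) ≠ 0 := by positivity
  push_cast at h1 ⊢
  field_simp

theorem multinomialCoeff_sub_single {n : ι →₀ ℕ} {x : ι} (hx : x ∈ n.support) :
    multinomialCoeff (n - Finsupp.single x 1) = multinomialCoeff n * n x / size n := by
  have h1 : 1 ≤ n x := Nat.one_le_iff_ne_zero.mpr (Finsupp.mem_support_iff.mp hx)
  have h : n - Finsupp.single x 1 + Finsupp.single x 1 = n :=
    tsub_add_cancel_of_le (Finsupp.single_le_iff.mpr h1)
  have h2 := multinomialCoeff_add_single (n - Finsupp.single x 1) x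
  have h3 := size_add_single (n - Finsupp.single x 1) x
  have h4 : ((n - Finsupp.single x 1 : ι →₀ ℕ) x : ℚ) + 1 = n x := by
    conv_rhs => rw [← h]
    simp
  rw [h] at h2 h3
  rw [h4] at h2
  rw [h2, h3]
  push_cast
  field_simp

/-- Removing one occurrence of a letter: the pairs of a family of weight `m` and a letter `x` in its
support correspond to the pairs of a letter and a family whose weights add up to `m`. -/
theorem sum_support_sub_single (hk : ∀ x, 1 ≤ k x) (hfin : ∀ n, {x | k x = n}.Finite)
    (f : ι → (ι →₀ ℕ) → ℚ) (m : ℕ) :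
    ∑ n ∈ (multiplicities_finite hk hfin m).toFinset, ∑ x ∈ n.support,
        f x (n - Finsupp.single x 1) =
      ∑ p ∈ antidiagonal m, ∑ x ∈ (hfin p.1).toFinset,
        ∑ n ∈ (multiplicities_finite hk hfin p.2).toFinset, f x n := by
  simp_rw [← Finset.sum_product']
  rw [Finset.sum_sigma', Finset.sum_sigma']
  refine Finset.sum_bij'
    (fun a _ => ⟨(k a.2, ∑ j ∈ (a.1 - Finsupp.single a.2 1).support,
      k j * (a.1 - Finsupp.single a.2 1 : ι →₀ ℕ) j), (a.2, a.1 - Finsupp.single a.2 1)⟩)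
    (fun b _ => ⟨b.2.2 + Finsupp.single b.2.1 1, b.2.1⟩) ?_ ?_ ?_ ?_ ?_
  · rintro ⟨n, x⟩ h
    simp only [mem_sigma, Set.Finite.mem_toFinset] at h
    have h1 : 1 ≤ n x := Nat.one_le_iff_ne_zero.mpr (Finsupp.mem_support_iff.mp h.2)
    have h2 := add_single_mem_multiplicities (k := k) (n := n - Finsupp.single x 1) rfl x
    rw [tsub_add_cancel_of_le (Finsupp.single_le_iff.mpr h1)] at h2
    simp only [mem_sigma, HasAntidiagonal.mem_antidiagonal, mem_product, Set.Finite.mem_toFinset,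
      Set.mem_ofPred_eq, true_and]
    exact ⟨(show _ = _ from h2).symm.trans h.1, rfl⟩
  · rintro ⟨⟨a, b⟩, x, n⟩ h
    simp only [mem_sigma, HasAntidiagonal.mem_antidiagonal, mem_product, Set.Finite.mem_toFinset,
      Set.mem_ofPred_eq] at h ⊢
    obtain ⟨rfl, rfl, h⟩ := h
    exact ⟨add_single_mem_multiplicities h x, by simp⟩
  · rintro ⟨n, x⟩ h
    simp only [mem_sigma] at h
    have h1 : 1 ≤ n x := Nat.one_le_iff_ne_zero.mpr (Finsupp.mem_support_iff.mp h.2)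
    simp only [tsub_add_cancel_of_le (Finsupp.single_le_iff.mpr h1)]
  · rintro ⟨⟨a, b⟩, x, n⟩ h
    simp only [mem_sigma, HasAntidiagonal.mem_antidiagonal, mem_product, Set.Finite.mem_toFinset,
      Set.mem_ofPred_eq] at h
    obtain ⟨rfl, rfl, h⟩ := h
    simp only [add_tsub_cancel_right]
    rw [show ∑ j ∈ n.support, k j * n j = b from h]
  · rintro ⟨n, x⟩ -
    rfl

/-! ### Generating series -/

/-- The generating series of the letters by weight. The coefficients use `Nat.card`, so the series
is meaningful when there are finitely many letters of each weight. -/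
noncomputable def letterSeries (k : ι → ℕ) : ℚ⟦X⟧ :=
  .mk fun n => (Nat.card {x // k x = n} : ℚ)

/-- The generating series `∑ X^|w|` of the words `w` by weight. -/
noncomputable def wordSeries (k : ι → ℕ) : ℚ⟦X⟧ :=
  .mk fun m => ∑ᶠ n ∈ multiplicities k m, multinomialCoeff n

/-- The generating series `∑ (|w| / length w) X^|w|` of the nonempty words by weight, which is
`X d/dX` applied to the logarithm of the series of words. -/
noncomputable def cyclicSeries (k : ι → ℕ) : ℚ⟦X⟧ :=
  .mk fun m => m * ∑ᶠ n ∈ multiplicities k m, multinomialCoeff n / size n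

theorem coeff_letterSeries (hfin : ∀ n, {x | k x = n}.Finite) (m : ℕ) :
    coeff m (letterSeries k) = ((hfin m).toFinset.card : ℚ) := by
  rw [letterSeries, coeff_mk, ← Set.ncard_eq_toFinset_card _ (hfin m)]
  rfl

theorem multiplicities_zero (hk : ∀ x, 1 ≤ k x) : multiplicities k 0 = {0} := by
  ext n
  simp only [multiplicities, Set.mem_ofPred_eq, Set.mem_singleton_iff, Finset.sum_eq_zero_iff]
  refine ⟨fun h => ?_, fun h => by simp [h]⟩
  ext j
  by_cases hj : j ∈ n.support
  · exact (Nat.mul_eq_zero.mp (h j hj)).resolve_left (Nat.one_le_iff_ne_zero.mp (hk j))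
  · exact Finsupp.notMem_support_iff.mp hj

theorem size_ne_zero_of_mem {n : ι →₀ ℕ} {m : ℕ} (hm : m ≠ 0) (hn : n ∈ multiplicities k m) :
    size n ≠ 0 := by
  rw [Ne, size_eq_zero]
  rintro rfl
  exact hm (by simpa [multiplicities] using hn.symm)

/-- A nonempty word is a letter followed by a word. -/
theorem wordSeries_eq (hk : ∀ x, 1 ≤ k x) (hfin : ∀ n, {x | k x = n}.Finite) :
    wordSeries k = 1 + letterSeries k * wordSeries k := by
  ext m
  rw [map_add, coeff_mul]
  simp_rw [coeff_letterSeries hfin, wordSeries, coeff_mk,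
    finsum_mem_eq_finite_toFinset_sum _ (multiplicities_finite hk hfin _)]
  have key := sum_support_sub_single hk hfin (fun _ n => multinomialCoeff n) m
  simp_rw [Finset.sum_const, nsmul_eq_mul] at key
  rw [← key]
  rcases eq_or_ne m 0 with rfl | hm
  · have : (multiplicities_finite hk hfin 0).toFinset = {0} := by
      ext n; rw [Set.Finite.mem_toFinset, multiplicities_zero hk]; simp
    rw [this]
    simp [multinomialCoeff, size]
  · rw [coeff_one, if_neg hm, zero_add]
    refine Finset.sum_congr rfl fun n hn => ?_
    rw [Set.Finite.mem_toFinset] at hn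
    have h0 : (size n : ℚ) ≠ 0 := Nat.cast_ne_zero.mpr (size_ne_zero_of_mem hm hn)
    rw [Finset.sum_congr rfl fun x hx => multinomialCoeff_sub_single hx, ← Finset.sum_div,
      ← Finset.mul_sum, ← Nat.cast_sum]
    exact (mul_div_cancel_right₀ _ h0).symm

/-- The derivative of the logarithm of `1 / (1 - A)` is `A' / (1 - A)`. -/
theorem cyclicSeries_eq (hk : ∀ x, 1 ≤ k x) (hfin : ∀ n, {x | k x = n}.Finite) :
    cyclicSeries k = X * d⁄dX ℚ (letterSeries k) * wordSeries k := by
  have hX : ∀ m, coeff m (X * d⁄dX ℚ (letterSeries k)) = m * ((hfin m).toFinset.card : ℚ) := by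
    rintro (_ | m)
    · simp
    · rw [coeff_succ_X_mul, coeff_derivative, coeff_letterSeries hfin, mul_comm]
      push_cast
      rfl
  ext m
  rw [coeff_mul]
  simp_rw [hX, wordSeries, cyclicSeries, coeff_mk,
    finsum_mem_eq_finite_toFinset_sum _ (multiplicities_finite hk hfin _)]
  have key := sum_support_sub_single hk hfin (fun x n => k x * multinomialCoeff n) m
  simp_rw [← Finset.mul_sum] at key
  have h : ∀ p ∈ antidiagonal m, ∑ x ∈ (hfin p.1).toFinset, (k x : ℚ) *
      ∑ n ∈ (multiplicities_finite hk hfin p.2).toFinset, multinomialCoeff n =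
      p.1 * ((hfin p.1).toFinset.card : ℚ) *
      ∑ n ∈ (multiplicities_finite hk hfin p.2).toFinset, multinomialCoeff n := fun p _ => by
    rw [Finset.sum_congr rfl fun x hx => by
      rw [(show k x = p.1 by simpa using hx)], Finset.sum_const, nsmul_eq_mul]
    ring
  rw [Finset.sum_congr rfl h] at key
  rw [← key, Finset.mul_sum]
  refine Finset.sum_congr rfl fun n hn => ?_
  rw [Set.Finite.mem_toFinset] at hn
  rw [Finset.sum_congr rfl fun x hx => by rw [multinomialCoeff_sub_single hx],
    ← (show ∑ j ∈ n.support, k j * n j = m from hn)]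
  push_cast
  rw [Finset.sum_mul]
  refine Finset.sum_congr rfl fun x _ => ?_
  ring

/-! ### Witt's sum and Möbius inversion -/

/-- The sum of Witt's second formula over all families of weight `m`. -/
noncomputable def wittSum (k : ι → ℕ) (m : ℕ) : ℚ := ∑ᶠ n ∈ multiplicities k m, wittM n

theorem size_smul (d : ℕ) (n : ι →₀ ℕ) : size (d • n) = d * size n := by
  rw [size_eq_sum (s := n.support) Finsupp.support_smul, size, Finset.mul_sum]
  rfl

theorem smul_mem_multiplicities {d : ℕ} {n : ι →₀ ℕ} {m : ℕ} (hn : n ∈ multiplicities k m) :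
    d • n ∈ multiplicities k (d * m) := by
  rw [mem_multiplicities_iff (s := n.support) Finsupp.support_smul,
    ← (show ∑ j ∈ n.support, k j * n j = m from hn), Finset.mul_sum]
  exact Finset.sum_congr rfl fun j _ => mul_left_comm _ _ _

theorem wittM_term_smul {d : ℕ} (hd : d ≠ 0) (n : ι →₀ ℕ) :
    (((((∑ j ∈ (d • n).support, (d • n) j) / d).factorial : ℕ) : ℚ) /
      ((∏ j ∈ (d • n).support, ((d • n) j / d).factorial : ℕ) : ℚ)) = multinomialCoeff n := by
  have hd' : 0 < d := Nat.pos_of_ne_zero hd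
  rw [← size, size_smul, Nat.mul_div_cancel_left _ hd',
    multinomialCoeff_eq (s := (d • n).support)]
  · congr 2
    refine Finset.prod_congr rfl fun j _ => ?_
    rw [Finsupp.smul_apply, smul_eq_mul, Nat.mul_div_cancel_left _ hd']
  · intro j
    simp [hd]

theorem exists_eq_smul_of_mem_divisors {n : ι →₀ ℕ} {d : ℕ}
    (hd : d ∈ (n.support.gcd n).divisors) : d ≠ 0 ∧ ∃ n' : ι →₀ ℕ, n = d • n' := by
  refine ⟨(Nat.pos_of_mem_divisors hd).ne', n.mapRange (· / d) (Nat.zero_div _), ?_⟩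
  ext j
  rw [Finsupp.smul_apply, Finsupp.mapRange_apply, smul_eq_mul]
  by_cases hj : j ∈ n.support
  · exact (Nat.mul_div_cancel' (Finset.dvd_gcd_iff.mp (Nat.dvd_of_mem_divisors hd) j hj)).symm
  · simp [Finsupp.notMem_support_iff.mp hj]

theorem mem_divisors_gcd_smul {n : ι →₀ ℕ} {d : ℕ} (hd : d ≠ 0) (hn : n ≠ 0) :
    d ∈ ((d • n).support.gcd (d • n)).divisors := by
  rw [Nat.mem_divisors]
  refine ⟨Finset.dvd_gcd fun j _ => Dvd.intro _ rfl, ?_⟩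
  rw [Ne, Finset.gcd_eq_zero_iff]
  intro h
  refine smul_ne_zero hd hn (Finsupp.ext fun j => ?_)
  by_cases hj : j ∈ (d • n).support
  · exact h j hj
  · exact Finsupp.notMem_support_iff.mp hj

theorem mapRange_div_smul {d : ℕ} (hd : d ≠ 0) (n : ι →₀ ℕ) :
    (d • n).mapRange (· / d) (Nat.zero_div _) = n := by
  ext j
  rw [Finsupp.mapRange_apply, Finsupp.smul_apply, smul_eq_mul,
    Nat.mul_div_cancel_left _ (Nat.pos_of_ne_zero hd)]

theorem eq_mul_of_smul_mem_multiplicities {d m : ℕ} {n : ι →₀ ℕ}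
    (hn : d • n ∈ multiplicities k m) : ∃ w, n ∈ multiplicities k w ∧ m = d * w :=
  ⟨_, rfl, (show _ = m from hn).symm.trans (smul_mem_multiplicities (k := k) (n := n) rfl)⟩

/-- Witt's sum in terms of the series of the letters alone. It comes from writing each family `n` as
`d • n'` for each common divisor `d` of its members. -/
theorem mul_wittSum (hk : ∀ x, 1 ≤ k x) (hfin : ∀ n, {x | k x = n}.Finite) {m : ℕ} (hm : m ≠ 0) :
    m * wittSum k m = ∑ d ∈ m.divisors,
      (ArithmeticFunction.moebius d : ℚ) * coeff (m / d) (cyclicSeries k) := by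
  simp_rw [wittSum, cyclicSeries, coeff_mk, wittM,
    finsum_mem_eq_finite_toFinset_sum _ (multiplicities_finite hk hfin _), Finset.mul_sum]
  rw [Finset.sum_sigma', Finset.sum_sigma']
  refine Finset.sum_bij'
    (fun a _ => ⟨a.2, a.1.mapRange (· / a.2) (Nat.zero_div _)⟩)
    (fun b _ => ⟨b.1 • b.2, b.1⟩) ?_ ?_ ?_ ?_ ?_
  · rintro ⟨n, d⟩ h
    simp only [mem_sigma, Set.Finite.mem_toFinset] at h ⊢
    obtain ⟨hd, n, rfl⟩ := exists_eq_smul_of_mem_divisors h.2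
    obtain ⟨w, hw, rfl⟩ := eq_mul_of_smul_mem_multiplicities h.1
    rw [mapRange_div_smul hd, Nat.mul_div_cancel_left _ (Nat.pos_of_ne_zero hd)]
    exact ⟨Nat.mem_divisors.mpr ⟨Dvd.intro _ rfl, hm⟩, hw⟩
  · rintro ⟨d, n⟩ h
    simp only [mem_sigma, Set.Finite.mem_toFinset] at h ⊢
    obtain ⟨w, rfl⟩ := Nat.dvd_of_mem_divisors h.1
    have hd := (Nat.pos_of_mem_divisors h.1).ne'
    rw [Nat.mul_div_cancel_left _ (Nat.pos_of_ne_zero hd)] at h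
    have hw : w ≠ 0 := right_ne_zero_of_mul hm
    exact ⟨smul_mem_multiplicities h.2, mem_divisors_gcd_smul hd fun h0 =>
      size_ne_zero_of_mem hw h.2 (size_eq_zero.mpr h0)⟩
  · rintro ⟨n, d⟩ h
    simp only [mem_sigma] at h
    obtain ⟨hd, n, rfl⟩ := exists_eq_smul_of_mem_divisors h.2
    simp only [mapRange_div_smul hd]
  · rintro ⟨d, n⟩ h
    simp only [mem_sigma] at h
    simp only [mapRange_div_smul (Nat.pos_of_mem_divisors h.1).ne']
  · rintro ⟨n, d⟩ h
    simp only [mem_sigma, Set.Finite.mem_toFinset] at h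
    obtain ⟨hd, n, rfl⟩ := exists_eq_smul_of_mem_divisors h.2
    obtain ⟨w, hw, rfl⟩ := eq_mul_of_smul_mem_multiplicities h.1
    simp only [mapRange_div_smul hd]
    have hs : (∑ j ∈ (d • n).support, (d • n) j) = d * size n := size_smul d n
    rw [wittM_term_smul hd, hs, Nat.mul_div_cancel_left _ (Nat.pos_of_ne_zero hd)]
    have h1 : (d : ℚ) ≠ 0 := Nat.cast_ne_zero.mpr hd
    have h2 : (size n : ℚ) ≠ 0 :=
      Nat.cast_ne_zero.mpr (size_ne_zero_of_mem (right_ne_zero_of_mul hm) hw)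
    push_cast
    field_simp

/-- Witt's sum is additive when the series `1 - A` are multiplicative, as it depends linearly on
the logarithm of `1 - A`. -/
theorem wittSum_eq_add {X Y Z : Type*} {k₁ : X → ℕ} {k₂ : Y → ℕ} {k₃ : Z → ℕ}
    (hk₁ : ∀ x, 1 ≤ k₁ x) (hk₂ : ∀ x, 1 ≤ k₂ x) (hk₃ : ∀ x, 1 ≤ k₃ x)
    (hf₁ : ∀ n, {x | k₁ x = n}.Finite) (hf₂ : ∀ n, {x | k₂ x = n}.Finite)
    (hf₃ : ∀ n, {x | k₃ x = n}.Finite)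
    (h : 1 - letterSeries k₁ = (1 - letterSeries k₂) * (1 - letterSeries k₃))
    {m : ℕ} (hm : m ≠ 0) : wittSum k₁ m = wittSum k₂ m + wittSum k₃ m := by
  have h₁ := wordSeries_eq hk₁ hf₁
  have h₂ := wordSeries_eq hk₂ hf₂
  have h₃ := wordSeries_eq hk₃ hf₃
  -- Both sides are inverse to `1 - letterSeries k₁`.
  have hU : wordSeries k₁ = wordSeries k₂ * wordSeries k₃ := by
    linear_combination (wordSeries k₂ * wordSeries k₃) * h₁ - wordSeries k₁ * h₂ -
      wordSeries k₁ * wordSeries k₂ * (1 - letterSeries k₂) * h₃ -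
      wordSeries k₁ * wordSeries k₂ * wordSeries k₃ * h
  have hD := congrArg (d⁄dX ℚ) h
  simp only [Derivation.leibniz, map_sub, Derivation.map_one_eq_zero, smul_eq_mul] at hD
  have hT : cyclicSeries k₁ = cyclicSeries k₂ + cyclicSeries k₃ := by
    rw [cyclicSeries_eq hk₁ hf₁, cyclicSeries_eq hk₂ hf₂, cyclicSeries_eq hk₃ hf₃, hU]
    linear_combination (-PowerSeries.X * wordSeries k₂ * wordSeries k₃) * hD +
      PowerSeries.X * d⁄dX ℚ (letterSeries k₃) * wordSeries k₃ * h₂ +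
      PowerSeries.X * d⁄dX ℚ (letterSeries k₂) * wordSeries k₂ * h₃
  have hm' : (m : ℚ) ≠ 0 := Nat.cast_ne_zero.mpr hm
  apply mul_left_cancel₀ hm'
  rw [mul_add, mul_wittSum hk₁ hf₁ hm, mul_wittSum hk₂ hf₂ hm, mul_wittSum hk₃ hf₃ hm, hT,
    ← Finset.sum_add_distrib]
  simp only [map_add, mul_add]

/-- The free Lie algebra on one letter of weight `a` is one-dimensional: only its letter counts. -/
theorem wittSum_single {a m : ℕ} (ha : a ≠ 0) (hm : m ≠ 0) :
    wittSum (fun _ : Unit => a) m = if a = m then 1 else 0 := by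
  have hM : ∀ n ∈ multiplicities (fun _ : Unit => a) m, a * n () = m := fun n hn => by
    rw [mem_multiplicities_iff (Finset.subset_univ _)] at hn
    simpa using hn
  have hw : ∀ n : Unit →₀ ℕ, n () ≠ 0 → wittM n = if n () = 1 then 1 else 0 := fun n hn => by
    have hs : n.support = {()} := by ext; simp [hn]
    have h : ∀ d ∈ (n ()).divisors, (ArithmeticFunction.moebius d : ℚ) *
        (((n () / d).factorial : ℚ) / ((n () / d).factorial : ℚ)) =
        ArithmeticFunction.moebius d := fun d _ => by
      rw [div_self (Nat.cast_ne_zero.mpr (Nat.factorial_ne_zero _)), mul_one]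
    simp only [wittM, hs, Finset.sum_singleton, Finset.gcd_singleton, Finset.prod_singleton,
      normalize_eq]
    rw [Finset.sum_congr rfl h, ← Int.cast_sum, ← ArithmeticFunction.coe_zeta_mul_apply,
      ArithmeticFunction.coe_zeta_mul_moebius, ArithmeticFunction.one_apply]
    split_ifs with h1
    · simp [h1]
    · simp
  rw [wittSum]
  split_ifs with h
  · subst h
    have : multiplicities (fun _ : Unit => a) a = {Finsupp.single () 1} := by
      ext n
      rw [mem_multiplicities_iff (Finset.subset_univ _), Set.mem_singleton_iff]
      simp only [univ_unique, PUnit.default_eq_unit, Finset.sum_singleton, Nat.mul_eq_left ha,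
        Finsupp.ext_iff, Finsupp.single_eq_same]
      exact ⟨fun h _ => h, fun h => h ()⟩
    rw [this, finsum_mem_singleton, hw _ (by simp)]
    simp
  · refine finsum_mem_of_eqOn_zero fun n hn => ?_
    have h1 := hM n hn
    rw [hw n (by rintro h0; rw [h0] at h1; exact hm h1.symm), if_neg]
    · rfl
    · intro h0; rw [h0, mul_one] at h1; exact h h1

/-! ### Elimination on the level of generating series -/

theorem letterSeries_eq_add {X Y Z : Type*} {k₁ : X → ℕ} {k₂ : Y → ℕ} {k₃ : Z → ℕ}
    (hf₁ : ∀ n, {x | k₁ x = n}.Finite) (hf₂ : ∀ n, {x | k₂ x = n}.Finite)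
    (e : X ⊕ Y ≃ Z) (he : ∀ s, k₃ (e s) = Sum.elim k₁ k₂ s) :
    letterSeries k₃ = letterSeries k₁ + letterSeries k₂ := by
  ext n
  have _ : Finite {x // k₁ x = n} := hf₁ n
  have _ : Finite {x // k₂ x = n} := hf₂ n
  have e' : {z // k₃ z = n} ≃ {x // k₁ x = n} ⊕ {y // k₂ y = n} :=
    (e.subtypeEquiv fun s => by rw [he]).symm.trans Equiv.subtypeSum
  rw [map_add, letterSeries, letterSeries, letterSeries, coeff_mk, coeff_mk, coeff_mk,
    Nat.card_congr e', Nat.card_sum, Nat.cast_add]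

theorem letterSeries_prod {X Y : Type*} {k₁ : X → ℕ} {k₂ : Y → ℕ}
    (hf₁ : ∀ n, {x | k₁ x = n}.Finite) (hf₂ : ∀ n, {x | k₂ x = n}.Finite) :
    letterSeries (fun p : X × Y => k₁ p.1 + k₂ p.2) = letterSeries k₁ * letterSeries k₂ := by
  ext n
  have h₁ : ∀ n, Finite {x // k₁ x = n} := hf₁
  have h₂ : ∀ n, Finite {x // k₂ x = n} := hf₂
  let e : {p : X × Y // k₁ p.1 + k₂ p.2 = n} ≃
      Σ ab : {ab : ℕ × ℕ // ab ∈ HasAntidiagonal.antidiagonal n},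
        {x // k₁ x = ab.1.1} × {y // k₂ y = ab.1.2} :=
    { toFun := fun p => ⟨⟨(k₁ p.1.1, k₂ p.1.2), HasAntidiagonal.mem_antidiagonal.mpr p.2⟩,
        ⟨p.1.1, rfl⟩, ⟨p.1.2, rfl⟩⟩
      invFun := fun s => ⟨(s.2.1.1, s.2.2.1), by
        rw [s.2.1.2, s.2.2.2]; exact HasAntidiagonal.mem_antidiagonal.mp s.1.2⟩
      left_inv := fun _ => rfl
      right_inv := by
        rintro ⟨⟨⟨a, b⟩, hab⟩, ⟨x, hx⟩, ⟨y, hy⟩⟩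
        dsimp only at hx hy
        subst hx hy
        rfl }
  rw [coeff_mul]
  simp only [letterSeries, coeff_mk]
  rw [Nat.card_congr e, Nat.card_sigma, Nat.cast_sum]
  simp only [Nat.card_prod, Nat.cast_mul]
  exact Finset.sum_coe_sort (HasAntidiagonal.antidiagonal n) fun p : ℕ × ℕ =>
    (Nat.card {x // k₁ x = p.1} : ℚ) * Nat.card {y // k₂ y = p.2}

theorem adWeight_fiber_finite {X Y : Type*} {k₁ : X → ℕ} {k₂ : Y → ℕ} (hk₂ : ∀ y, 1 ≤ k₂ y)
    (hf₁ : ∀ n, {x | k₁ x = n}.Finite) (hf₂ : ∀ n, {x | k₂ x = n}.Finite) (n : ℕ) :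
    {a | adWeight k₁ k₂ a = n}.Finite := by
  induction n using Nat.strong_induction_on with
  | _ n ih =>
    have h : ∀ y, {a | k₂ y + adWeight k₁ k₂ a = n}.Finite := fun y => by
      by_cases hy : k₂ y ≤ n
      · refine (ih (n - k₂ y) (by have := hk₂ y; omega)).subset fun a ha => ?_
        simp only [Set.mem_ofPred_eq] at ha ⊢
        omega
      · refine Set.finite_empty.subset fun a ha => ?_
        simp only [Set.mem_ofPred_eq] at ha
        omega
    refine (((hf₁ n).image fun x => (x, [])).union
      ((finite_setOf_le hf₂ n).biUnion fun y _ =>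
        (h y).image fun a => (a.1, y :: a.2))).subset ?_
    rintro ⟨x, _ | ⟨y, l⟩⟩ ha
    · left
      exact ⟨x, by simpa [adWeight] using ha, rfl⟩
    · right
      simp only [adWeight, Set.mem_ofPred_eq, List.map_cons, List.sum_cons] at ha
      simp only [Set.mem_iUnion]
      exact ⟨y, by simp only [Set.mem_ofPred_eq]; omega, (x, l),
        by simp only [adWeight, Set.mem_ofPred_eq]; omega, rfl⟩

/-- A letter `ad(y_1) ⋯ ad(y_l) (x)` either is `x` or is `ad(y_1)` of another such letter. -/
theorem letterSeries_adWeight {X Y : Type*} {k₁ : X → ℕ} {k₂ : Y → ℕ} (hk₂ : ∀ y, 1 ≤ k₂ y)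
    (hf₁ : ∀ n, {x | k₁ x = n}.Finite) (hf₂ : ∀ n, {x | k₂ x = n}.Finite) :
    letterSeries (adWeight k₁ k₂) =
      letterSeries k₁ + letterSeries k₂ * letterSeries (adWeight k₁ k₂) := by
  have hf := adWeight_fiber_finite hk₂ hf₁ hf₂
  rw [← letterSeries_prod hf₂ hf]
  let e : X ⊕ Y × (X × List Y) ≃ X × List Y :=
    { toFun := Sum.elim (fun x => (x, [])) fun p => (p.2.1, p.1 :: p.2.2)
      invFun := fun a => match a with
        | (x, []) => .inl x
        | (x, y :: l) => .inr (y, x, l)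
      left_inv := by rintro (x | ⟨y, x, l⟩) <;> rfl
      right_inv := by rintro ⟨x, _ | ⟨y, l⟩⟩ <;> rfl }
  refine letterSeries_eq_add hf₁ (fun n => ?_) e ?_
  · refine ((finite_setOf_le hf₂ n).prod (finite_setOf_le hf n)).subset fun p hp => ?_
    simp only [Set.mem_ofPred_eq] at hp
    simp only [Set.mem_prod, Set.mem_ofPred_eq]
    omega
  · rintro (x | ⟨y, x, l⟩)
    · simp [e, adWeight]
    · simp only [e, adWeight, Equiv.coe_fn_mk, Sum.elim_inr, List.map_cons, List.sum_cons]
      omega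

/-- The numerical form of Lazard elimination. With `A₁`, `A₂` and `C` the series of `X`, `Y` and
the letters `ad(y_1) ⋯ ad(y_l) (x)`, it is `1 - A₁ - A₂ = (1 - A₂) (1 - C)`, which holds as
`C = A₁ + A₂ C`. -/
theorem wittSum_elimination {X Y Z : Type*} {k₁ : X → ℕ} {k₂ : Y → ℕ} {k : Z → ℕ}
    (hk₁ : ∀ x, 1 ≤ k₁ x) (hk₂ : ∀ y, 1 ≤ k₂ y)
    (hf₁ : ∀ n, {x | k₁ x = n}.Finite) (hf₂ : ∀ n, {x | k₂ x = n}.Finite)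
    (hf : ∀ n, {x | k x = n}.Finite)
    (e : X ⊕ Y ≃ Z) (he : ∀ s, k (e s) = Sum.elim k₁ k₂ s) {m : ℕ} (hm : m ≠ 0) :
    wittSum k m = wittSum k₂ m + wittSum (adWeight k₁ k₂) m := by
  have hk : ∀ z, 1 ≤ k z := fun z => by
    obtain ⟨s, rfl⟩ := e.surjective z
    rw [he]
    exact s.casesOn hk₁ hk₂
  refine wittSum_eq_add (k₃ := adWeight k₁ k₂) hk hk₂
    (fun a => (hk₁ a.1).trans (Nat.le_add_right _ _)) hf hf₂
    (adWeight_fiber_finite hk₂ hf₁ hf₂) ?_ hm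
  linear_combination letterSeries_adWeight hk₂ hf₁ hf₂ - letterSeries_eq_add hf₁ hf₂ e he

end Counting

/-! ### Dimension count -/

section Dimension

variable (K : Type*) [Field K]

theorem IsCommutator.le_order {K : Type*} [Field K] {ι : Type*} {k : ι → ℕ} {a m : ℕ}
    {u : FreeLieAlgebra K ι} (hu : IsCommutator K k m u) (hk : ∀ x, a ≤ k x) : a ≤ m := by
  induction hu with
  | of j => exact hk j
  | lie _ _ h _ => exact h.trans (Nat.le_add_right _ _)

/-- The induction behind `finrank_commutatorSpan`: `b` measures how far the lower bound `a` for the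
weights is below `m + 1`, and `N` bounds the number of letters of weight `a`. Eliminating a letter
of weight `a` leaves fewer letters of weight `a`, and those it creates are heavier. -/
theorem finrank_commutatorSpan_aux {m : ℕ} (hm : m ≠ 0) (b : ℕ) :
    ∀ (a N : ℕ) (ι : Type*) (k : ι → ℕ), a + b = m + 1 → 1 ≤ a → (∀ x, a ≤ k x) →
      (∀ n, {x | k x = n}.Finite) → {x | k x = a}.ncard ≤ N →
      Module.Finite K (commutatorSpan K k m) ∧
        (Module.finrank K (commutatorSpan K k m) : ℚ) = wittSum k m := by
  induction b with
  | zero =>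
    intro a N ι k hab _ hk _ _
    -- All letters are heavier than `m`, so both sides vanish.
    have h : commutatorSpan K k m = ⊥ := by
      rw [commutatorSpan, Submodule.span_eq_bot]
      intro u hu
      have := IsCommutator.le_order hu hk
      omega
    have hM : multiplicities k m = ∅ := by
      refine Set.eq_empty_of_forall_notMem fun n hn => ?_
      have hn' : n ≠ 0 := fun h0 => size_ne_zero_of_mem hm hn (size_eq_zero.mpr h0)
      obtain ⟨x, hx⟩ := Finsupp.support_nonempty_iff.mpr hn'
      have h1 : k x * n x ≤ m := by
        rw [← (show ∑ j ∈ n.support, k j * n j = m from hn)]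
        exact Finset.single_le_sum (f := fun j => k j * n j) (fun _ _ => Nat.zero_le _) hx
      have h2 : k x ≤ k x * n x :=
        Nat.le_mul_of_pos_right _ (Nat.pos_of_ne_zero (Finsupp.mem_support_iff.mp hx))
      have h3 := hk x
      omega
    rw [h, wittSum, hM]
    exact ⟨inferInstance, by simp⟩
  | succ b ihb =>
    intro a N
    induction N with
    | zero =>
      intro ι k hab ha hk hf hN
      rw [Nat.le_zero, Set.ncard_eq_zero (hf a)] at hN
      refine ihb (a + 1) _ ι k (by omega) (by omega) (fun x => ?_) hf le_rfl
      have h1 : k x ≠ a := fun h => (hN ▸ (show x ∈ {x | k x = a} from h) : x ∈ (∅ : Set ι)).elim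
      have h2 := hk x
      omega
    | succ N ihN =>
      intro ι k hab ha hk hf hN
      by_cases hx : ∃ x, k x = a
      · obtain ⟨x, hx⟩ := hx
        have hk1 : ∀ y, 1 ≤ k y := fun y => ha.trans (hk y)
        have hf₁ : ∀ n, {y : {y : ι // y ≠ x} | k y = n}.Finite := fun n =>
          (hf n).preimage Subtype.val_injective.injOn
        have hf₂ : ∀ n, {y : Unit | k x = n}.Finite := fun n => Set.toFinite _
        have hfe := adWeight_fiber_finite (k₂ := fun _ : Unit => k x) (fun _ => hk1 x) hf₁ hf₂
        have hE := ihN (ElimIdx x) (elimWeight k x) hab ha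
          (fun z => (hk z.1).trans (Nat.le_add_right _ _)) hfe (by
            have hsub : ∀ z : ElimIdx x, elimWeight k x z = a → k z.1 = a ∧ z.2 = [] := by
              rintro ⟨y, _ | ⟨_, l⟩⟩ hz
              · simpa [adWeight] using hz
              · rw [elimWeight_cons] at hz
                have := hk1 y
                simp only [elimWeight, adWeight] at hz
                omega
            have h1 : {z : ElimIdx x | elimWeight k x z = a}.ncard ≤
                ({y | k y = a} \ {x}).ncard := by
              refine Set.ncard_le_ncard_of_injOn (fun z => z.1.1)
                (fun z hz => ⟨(hsub z hz).1, z.1.2⟩) ?_ ((hf a).subset Set.sdiff_subset)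
              rintro ⟨y, l⟩ hz ⟨y', l'⟩ hz' h
              have h1 := (hsub _ hz).2
              have h2 := (hsub _ hz').2
              simp only at h h1 h2
              rw [h1, h2, Subtype.ext h]
            rw [Set.ncard_sdiff_singleton_of_mem (show x ∈ {y | k y = a} from hx)] at h1
            omega)
        obtain ⟨hfinite, hrank⟩ := finrank_commutatorSpan_elim (K := K) k x m hE.1
        refine ⟨hfinite, ?_⟩
        let e : {y : ι // y ≠ x} ⊕ Unit ≃ ι :=
          Equiv.ofBijective (Sum.elim Subtype.val fun _ => x) (by
            constructor
            · rintro (⟨y, hy⟩ | _) (⟨z, hz⟩ | _) h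
              · simpa using h
              · exact (hy h).elim
              · exact (hz h.symm).elim
              · rfl
            · intro y
              by_cases h : y = x
              · exact ⟨.inr (), h.symm⟩
              · exact ⟨.inl ⟨y, h⟩, rfl⟩)
        rw [hrank, wittSum_elimination (fun y => hk1 y.1) (fun _ => hk1 x) hf₁ hf₂ hf e
          (by rintro (y | _) <;> rfl) hm, wittSum_single (Nat.one_le_iff_ne_zero.mp (hk1 x)) hm,
          ← hE.2, add_comm]
        push_cast
        rfl
      · refine ihN ι k hab ha hk hf ?_
        have : {x | k x = a} = ∅ := Set.eq_empty_of_forall_notMem fun x h => hx ⟨x, h⟩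
        rw [this, Set.ncard_empty]
        exact Nat.zero_le _

/-- Witt's formula for a weighted alphabet, possibly infinite, with finitely many letters of each
weight. -/
theorem finrank_commutatorSpan {ι : Type*} {k : ι → ℕ} (hk : ∀ x, 1 ≤ k x)
    (hf : ∀ n, {x | k x = n}.Finite) {m : ℕ} (hm : m ≠ 0) :
    Module.Finite K (commutatorSpan K k m) ∧
      (Module.finrank K (commutatorSpan K k m) : ℚ) = wittSum k m :=
  finrank_commutatorSpan_aux K hm m 1 _ ι k (add_comm _ _) le_rfl hk hf le_rfl

end Dimension

end WittCount

theorem theorem11 (K : Type*) [Field K] (r q : ℕ) (hq : q ≤ r)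
    (k : Fin r → ℕ) (hk : ∀ i, 1 ≤ k i) (m : ℕ) (hm : 1 ≤ m) :
    -- the sums below are finite
    (WittCount.multiplicities k m).Finite ∧
    (WittCount.multiplicities (fun t : WittCount.LastIdx r q => k t.1) m).Finite ∧
    (WittCount.multiplicities (WittCount.adOrder q k) m).Finite ∧
    -- the number of independent commutators of order `m`
    Module.Finite K (WittCount.commutatorSpan K k m) ∧
    (Module.finrank K (WittCount.commutatorSpan K k m) : ℚ) =
      ∑ᶠ n ∈ WittCount.multiplicities k m, WittCount.wittM n ∧
    -- the generalized McLachlan formula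
    ∑ᶠ n ∈ WittCount.multiplicities k m, WittCount.wittM n =
      ∑ᶠ n ∈ WittCount.multiplicities (fun t : WittCount.LastIdx r q => k t.1) m,
          WittCount.wittM n +
        ∑ᶠ n ∈ WittCount.multiplicities (WittCount.adOrder q k) m, WittCount.wittM n := by
  have hm' : m ≠ 0 := Nat.one_le_iff_ne_zero.mp hm
  have hf : ∀ n, {i | k i = n}.Finite := fun _ => Set.toFinite _
  have hf₁ : ∀ n, {i : WittCount.FirstIdx r q | k i.1 = n}.Finite := fun _ => Set.toFinite _
  have hf₂ : ∀ n, {t : WittCount.LastIdx r q | k t.1 = n}.Finite := fun _ => Set.toFinite _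
  have hfad : ∀ n, {a | WittCount.adOrder q k a = n}.Finite :=
    WittCount.adWeight_fiber_finite (fun t : WittCount.LastIdx r q => hk t.1) hf₁ hf₂
  obtain ⟨hfinite, hrank⟩ := WittCount.finrank_commutatorSpan K hk hf hm'
  refine ⟨WittCount.multiplicities_finite hk hf m,
    WittCount.multiplicities_finite (fun t : WittCount.LastIdx r q => hk t.1) hf₂ m,
    WittCount.multiplicities_finite (fun a : WittCount.AdIdx r q =>
      (hk a.1.1).trans (Nat.le_add_right _ _)) hfad m,
    hfinite, hrank, ?_⟩
  let e : WittCount.FirstIdx r q ⊕ WittCount.LastIdx r q ≃ Fin r :=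
    (Equiv.sumCongr (Equiv.refl _) (Equiv.subtypeEquivRight fun _ => not_lt.symm)).trans
      (Equiv.sumCompl fun i : Fin r => (i : ℕ) < q)
  exact WittCount.wittSum_elimination (fun i => hk i.1) (fun t => hk t.1) hf₁ hf₂ hf e
    (by rintro (i | t) <;> rfl) hm'
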